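/- Let $g:\mathbb{R}^n\to\mathbb{R}\cup\{+\infty\}$ be a proper polyhedral function (its domain $\{x: g(x)<\infty\}$ is nonempty and its epigraph is an intersection of finitely many closed half-spaces), and let $H(y):=g(y^2)$ for $y\in\mathbb{R}^n$, where $y^2$ is the componentwise square. Let $\bar y$ satisfy $H(\bar y)<\infty$, and set $\bar x=\bar y^2$ and $I=\{i:\bar x_i\neq 0\}$, with complement $I^c$. Let $\partial g(\bar x)$ be the (limiting) subdifferential of $g$ at $\bar x$, i.e. the set of all limits of sequences $u^k\in\hat\partial g(x^k)$ with $x^k\to\bar x$ and $g(x^k)\to g(\bar x)$, where $u\in\hat\partial g(x)$ means that $g(x)$ is finite and $g(z)\ge g(x)+\langle u,z-x\rangle+o(\|z-x\|)$ as $z\to x$. Let $v\in\partial g(\bar x)$ and $\lambda=2\,\bar y\circ v$, with $\circ$ the componentwise product. Then, for every $w\in\mathbb{R}^n$ with $w_i=0$ for all $i\in I$, $$d^2H(\bar y\,|\,\lambda)(w)=2\sup\Big\{\sum_{i\in I^c}w_i^2\,p_i \;:\; p\in\partial g(\bar x),\ p_i=v_i \text{ for all } i\in I\Big\},$$ as an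 equality in $[-\infty,+\infty]$, where the second subderivative is $$d^2H(\bar y\,|\,\lambda)(w):=\liminf_{t\downarrow 0,\ \tilde w\to w}\frac{H(\bar y+t\tilde w)-H(\bar y)-t\langle\lambda,\tilde w\rangle}{\tfrac12 t^2}.$$ -/

import Mathlib

open Filter Topology

namespace SquareReparam

/-- A polyhedral set: an intersection of finitely many closed half-spaces
(possibly none, or with zero normals, so that the whole space and `∅` are included). -/
def IsPolyhedralSet {V : Type*} [AddCommGroup V] [Module ℝ V] (S : Set V) : Prop :=
  ∃ (m : ℕ) (φ : Fin m → V →ₗ[ℝ] ℝ) (b : Fin m → ℝ), S = {z | ∀ j, φ j z ≤ b j}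

/-- An extended real-valued function is polyhedral if its epigraph is a polyhedral set. -/
def IsPolyhedralFun {V : Type*} [AddCommGroup V] [Module ℝ V] (f : V → EReal) : Prop :=
  IsPolyhedralSet {z : V × ℝ | f z.1 ≤ (z.2 : EReal)}

/-- A proper function: nonempty domain, and the value `-∞` is never taken. -/
def IsProperFun {V : Type*} (f : V → EReal) : Prop :=
  (∃ x, f x < ⊤) ∧ ∀ x, ⊥ < f x

section Variational

variable {E : Type*} [NormedAddCommGroup E] [InnerProductSpace ℝ E]

/-- The regular (Fréchet) subdifferential: `f x₀` is finite and
`f x ≥ f x₀ + ⟨v, x - x₀⟩ + o(‖x - x₀‖)` as `x → x₀`. -/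
def regularSubdifferential (f : E → EReal) (x₀ : E) : Set E :=
  {v | f x₀ ≠ ⊤ ∧ f x₀ ≠ ⊥ ∧
    ∀ ε : ℝ, 0 < ε → ∀ᶠ x in 𝓝 x₀,
      f x₀ + ((inner ℝ v (x - x₀) - ε * ‖x - x₀‖ : ℝ) : EReal) ≤ f x}

/-- The (limiting) subdifferential: limits of regular subgradients `vₖ` taken at points
`xₖ → x₀` with `f xₖ → f x₀`, where `f x₀` is finite. -/
def subdifferential (f : E → EReal) (x₀ : E) : Set E :=
  {v | f x₀ ≠ ⊤ ∧ f x₀ ≠ ⊥ ∧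
    ∃ (x : ℕ → E) (u : ℕ → E),
      Tendsto x atTop (𝓝 x₀) ∧ Tendsto (fun k => f (x k)) atTop (𝓝 (f x₀)) ∧
      Tendsto u atTop (𝓝 v) ∧ ∀ k, u k ∈ regularSubdifferential f (x k)}

/-- The second subderivative of `f` at `x₀` (where `f` is finite) for `v`, in the direction `w`:
the lower limit, as `t ↓ 0` and `w' → w` jointly, of
`(f (x₀ + t w') - f x₀ - t ⟨v, w'⟩) / (t² / 2)`. -/
noncomputable def secondSubderivative (f : E → EReal) (x₀ v w : E) : EReal :=
  liminf
    (fun q : ℝ × E =>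
      (f (x₀ + q.1 • q.2) - f x₀ - ((q.1 * inner ℝ v q.2 : ℝ) : EReal)) /
        ((q.1 ^ 2 / 2 : ℝ) : EReal))
    (𝓝[>] (0 : ℝ) ×ˢ 𝓝 w)

end Variational

/-- The componentwise (Hadamard) product `x ∘ y`. -/
def hadamard {n : ℕ} (x y : EuclideanSpace ℝ (Fin n)) : EuclideanSpace ℝ (Fin n) :=
  WithLp.toLp 2 (fun i => x i * y i)

/-- The square transformation `y ↦ y²`, taken componentwise. -/
def squareMap {n : ℕ} (y : EuclideanSpace ℝ (Fin n)) : EuclideanSpace ℝ (Fin n) :=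
  WithLp.toLp 2 (fun i => y i ^ 2)

/-- The support `{i | xᵢ ≠ 0}` of a vector. -/
noncomputable def supp {n : ℕ} (x : EuclideanSpace ℝ (Fin n)) : Finset (Fin n) :=
  Finset.univ.filter (fun i => x i ≠ 0)

end SquareReparam

/-! The linear term of `(y + t w)²` cancels against `t⟨λ, w⟩`, so only the `t²` scale matters.

Lower bound (`le_secondSubderivative`): polyhedral subgradients are global. If `p` is one agreeing
with `v` on `I`, its inequality at `(y + t w')²` bounds the quotient below by `2 ∑ w'ᵢ² pᵢ`, which
converges to the required value.

Upper bound: only a finite supremum `M` needs work. Linear programming duality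
(`exists_primal_of_dual_bound`, from `farkas`) gives `(z, s)` in the tangent cone of the epigraph
with `z = w²` off `I` and `s - ∑_I vᵢ zᵢ ≤ M`. A curve `w(t) → w` satisfies `(y + t w(t))² = y² + t²
z`. By polyhedrality `g` there is at most `g(y²) + t² s`, so the quotient along the curve is at most
`2 (s - ⟨λ, w(t)⟩ / t)`, whose limit is `≤ 2 M`. -/

namespace SquareReparam

/-- **Farkas' lemma** for finitely many linear functionals on a real vector space. -/
theorem farkas {V ι : Type*} [AddCommGroup V] [Module ℝ V] (s : Finset ι) :
    ∀ (A : ι → V →ₗ[ℝ] ℝ) (b : V →ₗ[ℝ] ℝ), (∀ x, (∀ j ∈ s, A j x ≤ 0) → b x ≤ 0) →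
      ∃ c : ι → ℝ, (∀ j ∈ s, 0 ≤ c j) ∧ ∀ x, b x = ∑ j ∈ s, c j * A j x := by
  classical
  induction s using Finset.induction_on with
  | empty =>
    intro A b h
    refine ⟨fun _ => 0, by simp, fun x => ?_⟩
    have h1 := h x (by simp)
    have h2 := h (-x) (by simp)
    rw [map_neg] at h2
    simp only [Finset.sum_empty]
    linarith
  | insert i s hi ih =>
    intro A b h
    by_cases hb : ∀ x, (∀ j ∈ s, A j x ≤ 0) → b x ≤ 0
    · obtain ⟨c, hc, hsum⟩ := ih A b hb
      refine ⟨fun j => if j = i then 0 else c j, fun j hj => ?_, fun x => ?_⟩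
      · by_cases hji : j = i
        · simp [hji]
        · simpa [hji] using hc j (Finset.mem_of_mem_insert_of_ne hj hji)
      · rw [Finset.sum_insert hi, hsum]
        simp only [if_true, zero_mul, zero_add]
        refine Finset.sum_congr rfl fun j hj => ?_
        rw [if_neg (ne_of_mem_of_not_mem hj hi)]
    · push Not at hb
      obtain ⟨x₁, hx₁, hbx₁⟩ := hb
      have hpos : 0 < A i x₁ := by
        by_contra hneg
        refine absurd (h x₁ fun j hj => ?_) (not_le.mpr hbx₁)
        rcases Finset.mem_insert.mp hj with rfl | hj
        · exact not_lt.mp hneg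
        · exact hx₁ j hj
      obtain ⟨x₀, hx₀, hbx₀, hone⟩ :
          ∃ x₀, (∀ j ∈ s, A j x₀ ≤ 0) ∧ 0 < b x₀ ∧ A i x₀ = 1 := by
        refine ⟨(A i x₁)⁻¹ • x₁, fun j hj => ?_, ?_, ?_⟩
        · rw [map_smul, smul_eq_mul]
          exact mul_nonpos_of_nonneg_of_nonpos (inv_nonneg.mpr hpos.le) (hx₁ j hj)
        · rw [map_smul, smul_eq_mul]
          exact mul_pos (inv_pos.mpr hpos) hbx₁
        · rw [map_smul, smul_eq_mul, inv_mul_cancel₀ hpos.ne']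
      -- Compose every functional with the projection `x ↦ x - A i x • x₀` onto the kernel of `A i`,
      -- which removes one constraint.
      obtain ⟨c, hc, hsum⟩ := ih (fun j => A j - A j x₀ • A i) (b - b x₀ • A i) (by
        intro x hx
        have key := h (x - A i x • x₀) (by
          intro j hj
          rcases Finset.mem_insert.mp hj with rfl | hj
          · simp [hone]
          · have := hx j hj
            simp only [LinearMap.sub_apply, LinearMap.smul_apply, smul_eq_mul] at this
            simp only [map_sub, map_smul, smul_eq_mul]
            linarith)
        simp only [map_sub, map_smul, smul_eq_mul] at key
        simp only [LinearMap.sub_apply, LinearMap.smul_apply, smul_eq_mul]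
        linarith)
      have hcoef : 0 ≤ b x₀ - ∑ j ∈ s, c j * A j x₀ := by
        have : ∑ j ∈ s, c j * A j x₀ ≤ 0 := Finset.sum_nonpos fun j hj =>
          mul_nonpos_of_nonneg_of_nonpos (hc j hj) (hx₀ j hj)
        linarith
      refine ⟨fun j => if j = i then b x₀ - ∑ j ∈ s, c j * A j x₀ else c j,
        fun j hj => ?_, fun x => ?_⟩
      · by_cases hji : j = i
        · simpa [hji] using hcoef
        · simpa [hji] using hc j (Finset.mem_of_mem_insert_of_ne hj hji)
      · have hx := hsum x
        simp only [LinearMap.sub_apply, LinearMap.smul_apply, smul_eq_mul, mul_sub,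
          Finset.sum_sub_distrib] at hx
        have hs : ∑ j ∈ s, c j * (A j x₀ * A i x) = (∑ j ∈ s, c j * A j x₀) * A i x := by
          rw [Finset.sum_mul]
          exact Finset.sum_congr rfl fun j _ => by ring
        rw [Finset.sum_insert hi]
        simp only [if_true]
        have hcongr : ∑ j ∈ s, (if j = i then b x₀ - ∑ j ∈ s, c j * A j x₀ else c j) * A j x =
            ∑ j ∈ s, c j * A j x :=
          Finset.sum_congr rfl fun j hj => by rw [if_neg (ne_of_mem_of_not_mem hj hi)]
        rw [hcongr]
        rw [hs] at hx
        linarith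

/-! ### Convexity and local conicity of polyhedral functions -/

section Polyhedral

variable {E : Type*} [NormedAddCommGroup E] [InnerProductSpace ℝ E]

theorem IsPolyhedralFun.le_on_segment {f : E → EReal} (hf : IsPolyhedralFun f) {x z : E}
    {a c t : ℝ} (hx : f x ≤ (a : EReal)) (hz : f z ≤ (c : EReal)) (ht : 0 ≤ t) (ht' : t ≤ 1) :
    f (x + t • (z - x)) ≤ ((a + t * (c - a) : ℝ) : EReal) := by
  obtain ⟨m, φ, b, h⟩ := hf
  have hx' : (x, a) ∈ {z | ∀ j, φ j z ≤ b j} := h ▸ hx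
  have hz' : (z, c) ∈ {z | ∀ j, φ j z ≤ b j} := h ▸ hz
  have key : (x + t • (z - x), a + t * (c - a)) ∈ {z | ∀ j, φ j z ≤ b j} := by
    intro j
    have e : (x + t • (z - x), a + t * (c - a)) = (1 - t) • (x, a) + t • (z, c) := by
      ext1
      · simp only [Prod.fst_add, Prod.smul_fst]
        module
      · simp only [Prod.snd_add, Prod.smul_snd, smul_eq_mul]
        ring
    rw [e, map_add, map_smul, map_smul, smul_eq_mul, smul_eq_mul]
    nlinarith [hx' j, hz' j, mul_le_mul_of_nonneg_left (hx' j) (sub_nonneg.mpr ht'),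
      mul_le_mul_of_nonneg_left (hz' j) ht]
  rw [← h] at key
  exact key

/-- By convexity, the local inequality at `x + t • (z - x)` can be divided by `t`; the error `ε` is
arbitrary. -/
theorem IsPolyhedralFun.le_of_mem_regularSubdifferential {f : E → EReal}
    (hf : IsPolyhedralFun f) {x z u : E} {a c : ℝ} (ha : f x = (a : EReal))
    (hu : u ∈ regularSubdifferential f x) (hz : f z ≤ (c : EReal)) :
    a + inner ℝ u (z - x) ≤ c := by
  refine le_of_forall_pos_le_add fun δ hδ => ?_
  set ε := δ / (‖z - x‖ + 1)
  have hn : 0 < ‖z - x‖ + 1 := by positivity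
  have hεpos : 0 < ε := by positivity
  have hcont : Tendsto (fun t : ℝ => x + t • (z - x)) (𝓝[>] 0) (𝓝 x) := by
    have : Tendsto (fun t : ℝ => x + t • (z - x)) (𝓝 0) (𝓝 (x + (0 : ℝ) • (z - x))) :=
      Continuous.tendsto (by fun_prop) 0
    rw [zero_smul, add_zero] at this
    exact this.mono_left nhdsWithin_le_nhds
  have hev := hcont.eventually (hu.2.2 ε hεpos)
  have hlt : ∀ᶠ t : ℝ in 𝓝[>] 0, t < 1 := nhdsWithin_le_nhds (Iio_mem_nhds one_pos)
  obtain ⟨t, ⟨h1, h2⟩, h3⟩ := ((hev.and hlt).and self_mem_nhdsWithin).exists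
  have ht : 0 < t := h3
  have h4 := h1.trans (hf.le_on_segment ha.le hz ht.le h2.le)
  rw [ha, ← EReal.coe_add, EReal.coe_le_coe_iff, add_sub_cancel_left, inner_smul_right,
    norm_smul, Real.norm_of_nonneg ht.le] at h4
  have h5 : t * (inner ℝ u (z - x) - ε * ‖z - x‖) ≤ t * (c - a) := by linarith
  have h6 := le_of_mul_le_mul_left h5 ht
  have h7 : ε * ‖z - x‖ ≤ δ := by
    have : ε * (‖z - x‖ + 1) = δ := div_mul_cancel₀ _ hn.ne'
    nlinarith
  linarith

/-- A subgradient of a polyhedral function is a global subgradient, and conversely. -/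
theorem IsPolyhedralFun.mem_subdifferential_iff {f : E → EReal} (hf : IsPolyhedralFun f)
    {x p : E} {a : ℝ} (ha : f x = (a : EReal)) :
    p ∈ subdifferential f x ↔ ∀ (z : E) (c : ℝ), f z ≤ (c : EReal) → a + inner ℝ p (z - x) ≤ c := by
  constructor
  · rintro ⟨-, -, y, u, hy, hfy, hu, hreg⟩ z c hz
    have hreal : ∀ k, f (y k) = ((f (y k)).toReal : EReal) := fun k =>
      (EReal.coe_toReal (hreg k).1 (hreg k).2.1).symm
    have hlim : Tendsto (fun k => (f (y k)).toReal) atTop (𝓝 a) := by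
      rw [ha] at hfy
      exact (EReal.tendsto_toReal (EReal.coe_ne_top a) (EReal.coe_ne_bot a)).comp hfy
    refine le_of_tendsto (hlim.add (hu.inner (tendsto_const_nhds.sub hy))) ?_
    exact Eventually.of_forall fun k =>
      hf.le_of_mem_regularSubdifferential (hreal k) (hreg k) hz
  · intro h
    have ht : f x ≠ ⊤ := ha ▸ EReal.coe_ne_top a
    have hb : f x ≠ ⊥ := ha ▸ EReal.coe_ne_bot a
    refine ⟨ht, hb, fun _ => x, fun _ => p, tendsto_const_nhds, tendsto_const_nhds,
      tendsto_const_nhds, fun _ => ⟨ht, hb, fun ε hε => Eventually.of_forall fun z => ?_⟩⟩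
    rw [ha, ← EReal.coe_add]
    refine EReal.le_of_forall_lt_iff_le.mp fun c hc => ?_
    rw [EReal.coe_le_coe_iff]
    have := h z c hc.le
    have : 0 ≤ ε * ‖z - x‖ := by positivity
    linarith

/-- Near a point of its graph, the epigraph of a polyhedral function is a polyhedral cone. -/
theorem IsPolyhedralFun.exists_tangent_cone {f : E → EReal} (hf : IsPolyhedralFun f)
    {x : E} {a : ℝ} (ha : f x = (a : EReal)) :
    ∃ (m : ℕ) (ψ : Fin m → E × ℝ →ₗ[ℝ] ℝ),
      (∀ (z : E) (c : ℝ), f z ≤ (c : EReal) → ∀ j, ψ j (z - x, c - a) ≤ 0) ∧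
      ∀ (h : E) (s : ℝ), (∀ j, ψ j (h, s) ≤ 0) →
        ∀ᶠ t : ℝ in 𝓝[>] 0, f (x + t • h) ≤ ((a + t * s : ℝ) : EReal) := by
  classical
  obtain ⟨m, φ, b, hepi⟩ := hf
  have hmem : ∀ z c, f z ≤ ((c : ℝ) : EReal) ↔ ∀ j, φ j (z, c) ≤ b j := fun z c => by
    have := Set.ext_iff.mp hepi (z, c)
    exact this
  have hxa := (hmem x a).mp ha.le
  -- Only active constraints cut out the cone; inactive ones stay strict for small `t`.
  refine ⟨m, fun j => if φ j (x, a) = b j then φ j else 0, fun z c hz j => ?_, fun h s hs => ?_⟩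
  · by_cases hj : φ j (x, a) = b j
    · have := (hmem z c).mp hz j
      simp only [hj, if_true]
      rw [← Prod.mk_sub_mk, map_sub]
      linarith
    · simp [hj]
  · have hall : ∀ᶠ t : ℝ in 𝓝[>] 0, ∀ j, φ j (x, a) + t * φ j (h, s) ≤ b j := by
      rw [eventually_all]
      intro j
      by_cases hj : φ j (x, a) = b j
      · filter_upwards [self_mem_nhdsWithin] with t ht
        have h1 := hs j
        simp only [hj, if_true] at h1
        rw [hj]
        have := mul_nonpos_of_nonneg_of_nonpos (le_of_lt ht) h1
        linarith
      · have hlt : φ j (x, a) < b j := lt_of_le_of_ne (hxa j) hj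
        have : Tendsto (fun t : ℝ => φ j (x, a) + t * φ j (h, s)) (𝓝 0)
            (𝓝 (φ j (x, a) + 0 * φ j (h, s))) := Continuous.tendsto (by fun_prop) 0
        rw [zero_mul, add_zero] at this
        exact ((this.mono_left nhdsWithin_le_nhds).eventually_lt_const hlt).mono
          fun t ht => ht.le
    filter_upwards [hall] with t ht
    rw [hmem]
    intro j
    have e : (x + t • h, a + t * s) = (x, a) + t • (h, s) := rfl
    rw [e, map_add, map_smul, smul_eq_mul]
    exact ht j

end Polyhedral

/-! ### Linear programming duality -/

section Coordinates

variable {n : ℕ}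

theorem inner_eq_sum (x y : EuclideanSpace ℝ (Fin n)) : inner ℝ x y = ∑ i, x i * y i := by
  simp only [PiLp.inner_apply, RCLike.inner_apply, conj_trivial]
  exact Finset.sum_congr rfl fun i _ => mul_comm _ _

/-- The linear map that keeps the coordinates in `I` and sends the others to a multiple of the
corresponding coordinates of `W`. -/
noncomputable def spliceMap (I : Finset (Fin n)) (W : EuclideanSpace ℝ (Fin n)) :
    EuclideanSpace ℝ (Fin n) × ℝ →ₗ[ℝ] EuclideanSpace ℝ (Fin n) where
  toFun q := WithLp.toLp 2 fun i => if i ∈ I then q.1 i else q.2 * W i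
  map_add' p q := by
    ext i
    by_cases hi : i ∈ I <;> simp [hi, add_mul]
  map_smul' c q := by
    ext i
    by_cases hi : i ∈ I <;> simp [hi, mul_assoc]

theorem spliceMap_apply (I : Finset (Fin n)) (W x : EuclideanSpace ℝ (Fin n)) (θ : ℝ)
    (i : Fin n) : spliceMap I W (x, θ) i = if i ∈ I then x i else θ * W i := rfl

/-- Linear programming duality: a bound on the dual values over
`{p | (p, -1) ∈ K°, p = v on I}` is attained by a primal feasible point. -/
theorem exists_primal_of_dual_bound {m : ℕ} (ψ : Fin m → EuclideanSpace ℝ (Fin n) × ℝ →ₗ[ℝ] ℝ)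
    (I : Finset (Fin n)) (v W : EuclideanSpace ℝ (Fin n)) (M : ℝ)
    (hv : ∀ h s, (∀ j, ψ j (h, s) ≤ 0) → inner ℝ v h ≤ s)
    (hM : ∀ p : EuclideanSpace ℝ (Fin n), (∀ h s, (∀ j, ψ j (h, s) ≤ 0) → inner ℝ p h ≤ s) →
      (∀ i ∈ I, p i = v i) → ∑ i ∈ Iᶜ, W i * p i ≤ M) :
    ∃ (z : EuclideanSpace ℝ (Fin n)) (s : ℝ), (∀ j, ψ j (z, s) ≤ 0) ∧
      (∀ i, i ∉ I → z i = W i) ∧ s - ∑ i ∈ I, v i * z i ≤ M := by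
  classical
  by_contra hcon
  push Not at hcon
  -- functionals on `((x, θ), s)`
  let S := spliceMap I W
  let F : (EuclideanSpace ℝ (Fin n) × ℝ) × ℝ →ₗ[ℝ] EuclideanSpace ℝ (Fin n) × ℝ :=
    S.prodMap LinearMap.id
  let vI : EuclideanSpace ℝ (Fin n) →ₗ[ℝ] ℝ :=
    ∑ i ∈ I, v i • (EuclideanSpace.proj i : EuclideanSpace ℝ (Fin n) →L[ℝ] ℝ).toLinearMap
  have hvI : ∀ x, vI x = ∑ i ∈ I, v i * x i := fun x => by simp [vI]
  let θ : (EuclideanSpace ℝ (Fin n) × ℝ) × ℝ →ₗ[ℝ] ℝ :=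
    (LinearMap.snd ℝ _ ℝ).comp (LinearMap.fst ℝ _ ℝ)
  let obj : (EuclideanSpace ℝ (Fin n) × ℝ) × ℝ →ₗ[ℝ] ℝ :=
    LinearMap.snd ℝ _ ℝ - vI.comp ((LinearMap.fst ℝ _ ℝ).comp (LinearMap.fst ℝ _ ℝ)) - M • θ
  have hobj : ∀ x t s, obj ((x, t), s) = s - (∑ i ∈ I, v i * x i) - M * t := fun x t s => by
    simp [obj, hvI, θ]
  -- The problem is homogenised by `θ`: a solution with `θ > 0` would rescale to the forbidden
  -- primal point, so the constraints force `θ ≤ 0`.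
  obtain ⟨c, hc, hsum⟩ := farkas (Finset.univ : Finset (Option (Fin m)))
    (fun o => o.elim obj fun j => (ψ j).comp F) θ (by
      rintro ⟨⟨x, t⟩, s⟩ hq
      by_contra hpos
      have ht : 0 < t := not_le.mp hpos
      have hψ : ∀ j, ψ j (S (x, t), s) ≤ 0 := fun j => hq (some j) (Finset.mem_univ _)
      have hob : obj ((x, t), s) ≤ 0 := hq none (Finset.mem_univ _)
      rw [hobj] at hob
      have key := hcon (t⁻¹ • S (x, t)) (t⁻¹ * s) (fun j => by
        have e : (t⁻¹ • S (x, t), t⁻¹ * s) = t⁻¹ • (S (x, t), s) := rfl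
        rw [e, map_smul, smul_eq_mul]
        exact mul_nonpos_of_nonneg_of_nonpos (inv_nonneg.mpr ht.le) (hψ j)) (fun i hi => by
          simp only [PiLp.smul_apply, S, spliceMap_apply, if_neg hi, smul_eq_mul]
          field_simp)
      have e : ∑ i ∈ I, v i * (t⁻¹ • S (x, t)) i = t⁻¹ * ∑ i ∈ I, v i * x i := by
        rw [Finset.mul_sum]
        refine Finset.sum_congr rfl fun i hi => ?_
        simp only [PiLp.smul_apply, S, spliceMap_apply, if_pos hi, smul_eq_mul]
        ring
      rw [e, ← mul_sub, inv_mul_eq_div, lt_div_iff₀ ht] at key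
      linarith)
  simp only [Fintype.sum_option, Option.elim_none, Option.elim_some, LinearMap.comp_apply] at hsum
  set α := c none
  have hα0 : 0 ≤ α := hc none (Finset.mem_univ _)
  let Ψ : EuclideanSpace ℝ (Fin n) × ℝ →ₗ[ℝ] ℝ := ∑ j, c (some j) • ψ j
  have hΨ : ∀ q, Ψ q = ∑ j, c (some j) * ψ j q := fun q => by simp [Ψ]
  have hid : ∀ x t s, t = α * (s - (∑ i ∈ I, v i * x i) - M * t) + Ψ (S (x, t), s) := by
    intro x t s
    have := hsum ((x, t), s)
    rw [hobj, ← hΨ] at this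
    exact this
  let ℓ : EuclideanSpace ℝ (Fin n) →ₗ[ℝ] ℝ := Ψ.comp (LinearMap.inl ℝ _ ℝ)
  let p' : EuclideanSpace ℝ (Fin n) := WithLp.toLp 2 fun i => ℓ (EuclideanSpace.single i 1)
  have hp' : ∀ h, ℓ h = inner ℝ p' h := fun h => by
    have hdec : h = ∑ i, h i • EuclideanSpace.single i (1 : ℝ) := by
      ext k
      simp [Pi.single_apply]
    conv_lhs => rw [hdec]
    rw [map_sum, inner_eq_sum]
    exact Finset.sum_congr rfl fun i _ => by rw [map_smul, smul_eq_mul, mul_comm]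
  have hΨs : ∀ s : ℝ, Ψ (0, s) = -(α * s) := fun s => by
    have := hid 0 0 s
    rw [Prod.mk_zero_zero, map_zero] at this
    simp at this
    linarith
  have hsplit : ∀ h s, Ψ (h, s) = inner ℝ p' h - α * s := fun h s => by
    have e : (h, s) = (h, 0) + ((0 : EuclideanSpace ℝ (Fin n)), s) := by simp
    rw [e, map_add, hΨs, ← hp']
    rfl
  have hΨle : ∀ h s, (∀ j, ψ j (h, s) ≤ 0) → inner ℝ p' h ≤ α * s := fun h s hs => by
    have : Ψ (h, s) ≤ 0 := by
      rw [hΨ]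
      exact Finset.sum_nonpos fun j _ =>
        mul_nonpos_of_nonneg_of_nonpos (hc (some j) (Finset.mem_univ _)) (hs j)
    rw [hsplit] at this
    linarith
  have hpI : ∀ i ∈ I, p' i = α * v i := fun i hi => by
    have h1 := hid (EuclideanSpace.single i 1) 0 0
    rw [hsplit] at h1
    have h2 : S (EuclideanSpace.single i 1, 0) = EuclideanSpace.single i 1 := by
      ext k
      simp only [S, spliceMap_apply]
      by_cases hk : k ∈ I
      · simp [hk]
      · have : k ≠ i := fun e => hk (e ▸ hi)
        simp [hk, this]
    have h3 : ∑ k ∈ I, v k * (EuclideanSpace.single i (1 : ℝ) : EuclideanSpace ℝ (Fin n)) k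
        = v i := by
      simp [hi]
    have h4 : inner ℝ p' (EuclideanSpace.single i (1 : ℝ)) = p' i := by
      rw [inner_eq_sum]
      simp
    rw [h2, h3, h4] at h1
    linarith
  have hpW : ∑ i ∈ Iᶜ, W i * p' i = 1 + α * M := by
    have h1 := hid 0 1 0
    rw [hsplit, inner_eq_sum] at h1
    have h2 : ∑ i, p' i * (S (0, 1)) i = ∑ i ∈ Iᶜ, W i * p' i := by
      rw [← Finset.sum_add_sum_compl I]
      have h3 : ∑ i ∈ I, p' i * (S (0, 1)) i = 0 := Finset.sum_eq_zero fun i hi => by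
        simp [S, spliceMap_apply, hi]
      rw [h3, zero_add]
      refine Finset.sum_congr rfl fun i hi => ?_
      simp only [S, spliceMap_apply, if_neg (Finset.mem_compl.mp hi)]
      ring
    rw [h2] at h1
    simp at h1
    linarith
  -- Since `α` may vanish, `p'` cannot be normalised alone; mixing it with the feasible `v` covers
  -- both cases, and letting `τ` grow contradicts the bound.
  have hray : ∀ τ : ℝ, 0 ≤ τ → ∑ i ∈ Iᶜ, W i * v i + τ ≤ M := fun τ hτ => by
    have hd : 0 < 1 + τ * α := by positivity
    have key := hM ((1 + τ * α)⁻¹ • (v + τ • p')) (fun h s hs => by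
      rw [real_inner_smul_left, inner_add_left, real_inner_smul_left, inv_mul_le_iff₀ hd]
      nlinarith [hv h s hs, mul_le_mul_of_nonneg_left (hΨle h s hs) hτ]) (fun i hi => by
        simp only [PiLp.smul_apply, PiLp.add_apply, smul_eq_mul, hpI i hi]
        field_simp)
    have e : ∑ i ∈ Iᶜ, W i * ((1 + τ * α)⁻¹ • (v + τ • p')) i =
        (1 + τ * α)⁻¹ * (∑ i ∈ Iᶜ, W i * v i + τ * ∑ i ∈ Iᶜ, W i * p' i) := by
      rw [Finset.mul_sum, ← Finset.sum_add_distrib, Finset.mul_sum]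
      refine Finset.sum_congr rfl fun i _ => ?_
      simp only [PiLp.smul_apply, PiLp.add_apply, smul_eq_mul]
      ring
    rw [e, hpW, inv_mul_le_iff₀ hd] at key
    linarith
  have h0 := hray (|M - ∑ i ∈ Iᶜ, W i * v i| + 1) (by positivity)
  have := le_abs_self (M - ∑ i ∈ Iᶜ, W i * v i)
  linarith

/-! ### Lower bound from subgradients -/

theorem IsPolyhedralFun.le_of_mem_subdifferential {E : Type*} [NormedAddCommGroup E]
    [InnerProductSpace ℝ E] {f : E → EReal} (hf : IsPolyhedralFun f) {x p : E} {a : ℝ}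
    (ha : f x = (a : EReal)) (hp : p ∈ subdifferential f x) (z : E) :
    ((a + inner ℝ p (z - x) : ℝ) : EReal) ≤ f z := by
  refine EReal.le_of_forall_lt_iff_le.mp fun c hc => ?_
  rw [EReal.coe_le_coe_iff]
  exact (hf.mem_subdifferential_iff ha).mp hp z c hc.le

theorem squareMap_apply (y : EuclideanSpace ℝ (Fin n)) (i : Fin n) : squareMap y i = y i ^ 2 := rfl

theorem hadamard_apply (x y : EuclideanSpace ℝ (Fin n)) (i : Fin n) :
    hadamard x y i = x i * y i := rfl

theorem mem_supp_squareMap {y : EuclideanSpace ℝ (Fin n)} {i : Fin n} :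
    i ∈ supp (squareMap y) ↔ y i ≠ 0 := by
  simp [supp, squareMap_apply]

theorem inner_squareMap_sub {y v p w : EuclideanSpace ℝ (Fin n)}
    (hp : ∀ i ∈ supp (squareMap y), p i = v i) (t : ℝ) :
    inner ℝ p (squareMap (y + t • w) - squareMap y) - t * inner ℝ ((2 : ℝ) • hadamard y v) w =
      t ^ 2 * ∑ i, w i ^ 2 * p i := by
  rw [inner_eq_sum, inner_eq_sum, Finset.mul_sum, Finset.mul_sum, ← Finset.sum_sub_distrib]
  refine Finset.sum_congr rfl fun i _ => ?_
  simp only [PiLp.sub_apply, PiLp.smul_apply, smul_eq_mul, squareMap_apply, hadamard_apply,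
    PiLp.add_apply]
  by_cases hi : y i = 0
  · rw [hi]
    ring
  · rw [hp i (mem_supp_squareMap.mpr hi)]
    ring

theorem tendsto_sum_sq_mul (p w : EuclideanSpace ℝ (Fin n)) {I : Finset (Fin n)}
    (hw : ∀ i ∈ I, w i = 0) :
    Tendsto (fun q : ℝ × EuclideanSpace ℝ (Fin n) => 2 * ∑ i, q.2 i ^ 2 * p i)
      (𝓝[>] (0 : ℝ) ×ˢ 𝓝 w) (𝓝 (2 * ∑ i ∈ Iᶜ, w i ^ 2 * p i)) := by
  have e : ∑ i ∈ Iᶜ, w i ^ 2 * p i = ∑ i, w i ^ 2 * p i := by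
    have h0 : ∑ i ∈ I, w i ^ 2 * p i = 0 := Finset.sum_eq_zero fun i hi => by simp [hw i hi]
    rw [← Finset.sum_add_sum_compl I, h0, zero_add]
  rw [e]
  have hc : Continuous fun x : EuclideanSpace ℝ (Fin n) => 2 * ∑ i, x i ^ 2 * p i := by fun_prop
  exact (hc.tendsto w).comp tendsto_snd

theorem le_secondSubderivative {g : EuclideanSpace ℝ (Fin n) → EReal} (hg : IsPolyhedralFun g)
    {y v w p : EuclideanSpace ℝ (Fin n)} {a : ℝ} (ha : g (squareMap y) = (a : EReal))
    (hw : ∀ i ∈ supp (squareMap y), w i = 0) (hp : p ∈ subdifferential g (squareMap y))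
    (hpv : ∀ i ∈ supp (squareMap y), p i = v i) :
    ((2 * ∑ i ∈ (supp (squareMap y))ᶜ, w i ^ 2 * p i : ℝ) : EReal) ≤
      secondSubderivative (fun y => g (squareMap y)) y ((2 : ℝ) • hadamard y v) w := by
  have hlim := (continuous_coe_real_ereal.tendsto _).comp (tendsto_sum_sq_mul p w hw)
  rw [← hlim.liminf_eq]
  refine liminf_le_liminf ?_
  have hpos : ∀ᶠ q : ℝ × EuclideanSpace ℝ (Fin n) in 𝓝[>] (0 : ℝ) ×ˢ 𝓝 w, 0 < q.1 :=
    tendsto_fst.eventually self_mem_nhdsWithin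
  filter_upwards [hpos] with q hq
  have hle := hg.le_of_mem_subdifferential ha hp (squareMap (y + q.1 • q.2))
  have hd : 0 < q.1 ^ 2 / 2 := by positivity
  refine le_trans (le_of_eq ?_) (EReal.div_le_div_right_of_nonneg (EReal.coe_nonneg.mpr hd.le)
    (EReal.sub_le_sub (EReal.sub_le_sub hle ha.le) le_rfl))
  rw [← EReal.coe_sub, ← EReal.coe_sub, ← EReal.coe_div, add_sub_cancel_left,
    inner_squareMap_sub hpv]
  simp only [Function.comp_apply]
  congr 1
  field_simp

/-! ### Upper bound along a recovery curve -/

/-- A curve through `w` along which `y ↦ y²` moves from `y²` exactly by `t² z`. -/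
noncomputable def squareCurve (y w z : EuclideanSpace ℝ (Fin n)) (t : ℝ) :
    EuclideanSpace ℝ (Fin n) :=
  -- On the support this is `yᵢ (√(1 + t² zᵢ / yᵢ²) - 1) / t`, rationalised to be regular at `t =
  -- 0`. Where `yᵢ = 0`, division by zero gives `0` and leaves `wᵢ`.
  WithLp.toLp 2 fun i => w i + t * (z i / (y i * (1 + √(1 + t ^ 2 * (z i / y i ^ 2)))))

theorem tendsto_squareCurve_coeff (y z : EuclideanSpace ℝ (Fin n)) (i : Fin n) :
    Tendsto (fun t : ℝ => z i / (y i * (1 + √(1 + t ^ 2 * (z i / y i ^ 2))))) (𝓝[>] 0)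
      (𝓝 (z i / (y i * 2))) := by
  by_cases hi : y i = 0
  · simp [hi]
  have hc : ContinuousAt (fun t : ℝ => z i / (y i * (1 + √(1 + t ^ 2 * (z i / y i ^ 2))))) 0 := by
    refine ContinuousAt.div (by fun_prop) (by fun_prop) ?_
    have : 0 < 1 + √(1 + (0 : ℝ) ^ 2 * (z i / y i ^ 2)) := by positivity
    exact mul_ne_zero hi this.ne'
  have := hc.tendsto.mono_left (nhdsWithin_le_nhds (s := Set.Ioi (0 : ℝ)))
  norm_num at this
  convert this using 2

theorem tendsto_squareCurve (y w z : EuclideanSpace ℝ (Fin n)) :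
    Tendsto (squareCurve y w z) (𝓝[>] 0) (𝓝 w) := by
  have h : Tendsto (fun t i => w i + t * (z i / (y i * (1 + √(1 + t ^ 2 * (z i / y i ^ 2))))))
      (𝓝[>] (0 : ℝ)) (𝓝 fun i => w i) := by
    refine tendsto_pi_nhds.mpr fun i => ?_
    have ht : Tendsto (fun t : ℝ => t) (𝓝[>] 0) (𝓝 0) := tendsto_id.mono_left nhdsWithin_le_nhds
    have := (ht.mul (tendsto_squareCurve_coeff y z i)).const_add (w i)
    rwa [zero_mul, add_zero] at this
  exact ((PiLp.continuous_toLp 2 _).tendsto _).comp h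

theorem eventually_squareMap_squareCurve {y w z : EuclideanSpace ℝ (Fin n)}
    (hw : ∀ i ∈ supp (squareMap y), w i = 0) (hz : ∀ i, i ∉ supp (squareMap y) → z i = w i ^ 2) :
    ∀ᶠ t : ℝ in 𝓝[>] 0,
      squareMap (y + t • squareCurve y w z t) = squareMap y + t ^ 2 • z := by
  have hall : ∀ᶠ t : ℝ in 𝓝[>] 0, ∀ i, 0 ≤ 1 + t ^ 2 * (z i / y i ^ 2) := by
    rw [eventually_all]
    intro i
    have : Tendsto (fun t : ℝ => 1 + t ^ 2 * (z i / y i ^ 2)) (𝓝 0)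
        (𝓝 (1 + 0 ^ 2 * (z i / y i ^ 2))) := Continuous.tendsto (by fun_prop) 0
    refine ((this.mono_left nhdsWithin_le_nhds).eventually_const_lt ?_).mono fun t ht => ht.le
    norm_num
  filter_upwards [hall] with t ht
  ext i
  simp only [squareMap_apply, PiLp.add_apply, PiLp.smul_apply, smul_eq_mul, squareCurve]
  by_cases hi : y i = 0
  · rw [hz i (fun h => mem_supp_squareMap.mp h hi), hi]
    simp
    ring
  · rw [hw i (mem_supp_squareMap.mpr hi), zero_add]
    have hR := Real.sq_sqrt (ht i)
    have hR0 := Real.sqrt_nonneg (1 + t ^ 2 * (z i / y i ^ 2))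
    set R := √(1 + t ^ 2 * (z i / y i ^ 2))
    have h1 : 1 + R ≠ 0 := by positivity
    have h2 : t ^ 2 * z i = y i ^ 2 * (R ^ 2 - 1) := by
      rw [hR]
      field_simp
      ring
    have h3 : y i + t * (t * (z i / (y i * (1 + R)))) = y i * R := by
      have : t * (t * (z i / (y i * (1 + R)))) = t ^ 2 * z i / (y i * (1 + R)) := by ring
      rw [this, h2]
      field_simp
      ring
    rw [h3, h2]
    ring

theorem tendsto_inner_squareCurve_div {y v w z : EuclideanSpace ℝ (Fin n)}
    (hw : ∀ i ∈ supp (squareMap y), w i = 0) :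
    Tendsto (fun t : ℝ => inner ℝ ((2 : ℝ) • hadamard y v) (squareCurve y w z t) / t) (𝓝[>] 0)
      (𝓝 (∑ i ∈ supp (squareMap y), v i * z i)) := by
  have hlim := tendsto_finsetSum (supp (squareMap y)) fun i _ =>
    (tendsto_squareCurve_coeff y z i).const_mul (2 * (y i * v i))
  have e : ∑ i ∈ supp (squareMap y), 2 * (y i * v i) * (z i / (y i * 2)) =
      ∑ i ∈ supp (squareMap y), v i * z i := by
    refine Finset.sum_congr rfl fun i hi => ?_
    have := mem_supp_squareMap.mp hi
    field_simp
  rw [e] at hlim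
  refine hlim.congr' ?_
  filter_upwards [self_mem_nhdsWithin] with t ht
  have ht0 : t ≠ 0 := ne_of_gt ht
  rw [inner_eq_sum, ← Finset.sum_add_sum_compl (supp (squareMap y))]
  have h0 : ∑ i ∈ (supp (squareMap y))ᶜ, ((2 : ℝ) • hadamard y v) i * squareCurve y w z t i = 0 := by
    refine Finset.sum_eq_zero fun i hi => ?_
    have hyi : y i = 0 := by
      by_contra h
      exact Finset.mem_compl.mp hi (mem_supp_squareMap.mpr h)
    simp [hadamard_apply, hyi]
  rw [h0, add_zero, Finset.sum_div]
  refine Finset.sum_congr rfl fun i hi => ?_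
  simp only [PiLp.smul_apply, hadamard_apply, squareCurve, hw i hi, zero_add, smul_eq_mul]
  field_simp

theorem secondSubderivative_le {g : EuclideanSpace ℝ (Fin n) → EReal}
    {y v w z : EuclideanSpace ℝ (Fin n)} {a s : ℝ} (ha : g (squareMap y) = (a : EReal))
    (hw : ∀ i ∈ supp (squareMap y), w i = 0) (hz : ∀ i, i ∉ supp (squareMap y) → z i = w i ^ 2)
    (hs : ∀ᶠ t : ℝ in 𝓝[>] 0, g (squareMap y + t • z) ≤ ((a + t * s : ℝ) : EReal)) :
    secondSubderivative (fun y => g (squareMap y)) y ((2 : ℝ) • hadamard y v) w ≤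
      ((2 * (s - ∑ i ∈ supp (squareMap y), v i * z i) : ℝ) : EReal) := by
  have hpath : Tendsto (fun t : ℝ => (t, squareCurve y w z t)) (𝓝[>] 0)
      (𝓝[>] (0 : ℝ) ×ˢ 𝓝 w) := tendsto_id.prodMk (tendsto_squareCurve y w z)
  have hsq : Tendsto (fun t : ℝ => t ^ 2) (𝓝[>] 0) (𝓝[>] 0) := by
    refine tendsto_nhdsWithin_iff.mpr ⟨?_, ?_⟩
    · have : Tendsto (fun t : ℝ => t ^ 2) (𝓝 0) (𝓝 (0 ^ 2)) := Continuous.tendsto (by fun_prop) 0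
      rw [zero_pow two_ne_zero] at this
      exact this.mono_left nhdsWithin_le_nhds
    · filter_upwards [self_mem_nhdsWithin] with t ht
      exact pow_pos (Set.mem_Ioi.mp ht) 2
  have hlim : Tendsto
      (fun t : ℝ => 2 * (s - inner ℝ ((2 : ℝ) • hadamard y v) (squareCurve y w z t) / t))
      (𝓝[>] 0) (𝓝 (2 * (s - ∑ i ∈ supp (squareMap y), v i * z i))) :=
    ((tendsto_inner_squareCurve_div hw).const_sub s).const_mul 2
  have hlim' := (continuous_coe_real_ereal.tendsto _).comp hlim
  rw [← hlim'.liminf_eq]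
  unfold secondSubderivative
  -- Restricting to the curve can only raise the lower limit.
  refine (liminf_le_liminf_of_le hpath).trans ?_
  rw [← liminf_comp]
  refine liminf_le_liminf ?_
  filter_upwards [self_mem_nhdsWithin, eventually_squareMap_squareCurve hw hz,
    hsq.eventually hs] with t ht hcurve hle
  have ht0 : (0 : ℝ) < t := ht
  have hd : 0 < t ^ 2 / 2 := by positivity
  simp only [Function.comp_apply]
  rw [hcurve]
  refine (EReal.div_le_div_right_of_nonneg (EReal.coe_nonneg.mpr hd.le)
    (EReal.sub_le_sub (EReal.sub_le_sub hle ha.ge) le_rfl)).trans (le_of_eq ?_)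
  rw [← EReal.coe_sub, ← EReal.coe_sub, ← EReal.coe_div, add_sub_cancel_left]
  congr 1
  field_simp

end Coordinates

end SquareReparam

theorem proposition4p2 (n : ℕ) (g : EuclideanSpace ℝ (Fin n) → EReal)
    (hproper : SquareReparam.IsProperFun g) (hpoly : SquareReparam.IsPolyhedralFun g)
    (H : EuclideanSpace ℝ (Fin n) → EReal)
    (hH : ∀ y, H y = g (SquareReparam.squareMap y))
    (ybar xbar v lam : EuclideanSpace ℝ (Fin n))
    (hy : H ybar < ⊤)
    (hx : xbar = SquareReparam.squareMap ybar)
    (hv : v ∈ SquareReparam.subdifferential g xbar)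
    (hlam : lam = (2 : ℝ) • SquareReparam.hadamard ybar v)
    (I : Finset (Fin n)) (hI : I = SquareReparam.supp xbar)
    (w : EuclideanSpace ℝ (Fin n)) (hw : ∀ i ∈ I, w i = 0) :
    SquareReparam.secondSubderivative H ybar lam w =
      2 * ⨆ p ∈ {p : EuclideanSpace ℝ (Fin n) |
            p ∈ SquareReparam.subdifferential g xbar ∧ ∀ i ∈ I, p i = v i},
          ((∑ i ∈ Iᶜ, w i ^ 2 * p i : ℝ) : EReal) := by
  obtain rfl : H = fun y => g (SquareReparam.squareMap y) := funext hH
  subst hx hlam hI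
  obtain ⟨a, ha⟩ : ∃ a : ℝ, g (SquareReparam.squareMap ybar) = (a : EReal) :=
    ⟨_, (EReal.coe_toReal hy.ne (hproper.2 _).ne').symm⟩
  have hmem := fun p => hpoly.mem_subdifferential_iff (p := p) ha
  set S : EReal := ⨆ p ∈ {p : EuclideanSpace ℝ (Fin n) |
      p ∈ SquareReparam.subdifferential g (SquareReparam.squareMap ybar) ∧
        ∀ i ∈ SquareReparam.supp (SquareReparam.squareMap ybar), p i = v i},
    ((∑ i ∈ (SquareReparam.supp (SquareReparam.squareMap ybar))ᶜ, w i ^ 2 * p i : ℝ) : EReal)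
  have hvS : ((∑ i ∈ (SquareReparam.supp (SquareReparam.squareMap ybar))ᶜ, w i ^ 2 * v i : ℝ) :
      EReal) ≤ S := le_iSup₂_of_le v ⟨hv, fun _ _ => rfl⟩ le_rfl
  apply le_antisymm
  · rcases eq_or_ne S ⊤ with htop | htop
    · rw [htop, EReal.mul_top_of_pos (by norm_num)]
      exact le_top
    have hbot : S ≠ ⊥ := ne_bot_of_le_ne_bot (EReal.coe_ne_bot _) hvS
    obtain ⟨M, hM⟩ : ∃ M : ℝ, S = (M : EReal) := ⟨_, (EReal.coe_toReal htop hbot).symm⟩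
    obtain ⟨m, ψ, hcone, hloc⟩ := hpoly.exists_tangent_cone ha
    obtain ⟨z, s, hzs, hzw, hsM⟩ := SquareReparam.exists_primal_of_dual_bound ψ
      (SquareReparam.supp (SquareReparam.squareMap ybar)) v (SquareReparam.squareMap w) M
      -- `v` is dual feasible: apply its subgradient inequality a short way along the cone
      -- direction.
      (fun h s hs => by
        obtain ⟨t, hle, ht⟩ := ((hloc h s hs).and self_mem_nhdsWithin).exists
        have := (hmem v).mp hv _ _ hle
        rw [add_sub_cancel_left, real_inner_smul_right] at this
        exact le_of_mul_le_mul_left (by linarith) (Set.mem_Ioi.mp ht))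
      (fun p hp hpv => by
        have hpS : ((∑ i ∈ (SquareReparam.supp (SquareReparam.squareMap ybar))ᶜ,
            w i ^ 2 * p i : ℝ) : EReal) ≤ S :=
          le_iSup₂_of_le p ⟨(hmem p).mpr fun z c hz => by
            have := hp _ _ (hcone z c hz)
            linarith, hpv⟩ le_rfl
        rw [hM, EReal.coe_le_coe_iff] at hpS
        exact hpS)
    refine (SquareReparam.secondSubderivative_le ha hw hzw (hloc z s hzs)).trans ?_
    rw [hM, EReal.coe_mul]
    exact mul_le_mul_of_nonneg_left (EReal.coe_le_coe_iff.mpr hsM) (by norm_num)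
  · have h2 : (2 : EReal) ≠ ⊤ := EReal.coe_ne_top 2
    rw [mul_comm, ← EReal.le_div_iff_mul_le (by norm_num) h2]
    refine iSup₂_le fun p hp => ?_
    rw [EReal.le_div_iff_mul_le (by norm_num) h2, mul_comm]
    have := SquareReparam.le_secondSubderivative hpoly ha hw hp.1 hp.2
    rwa [EReal.coe_mul] at this
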